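/- **BSS machines.** Let $\mathbb{R}^*=\bigcup_{n\ge 0}\mathbb{R}^n$ and $\operatorname{size}(\vec x)=n$ for $\vec x\in\mathbb{R}^n$. A BSS machine has an unbounded tape of real cells, a reading and a writing head, finitely many states, and finitely many real constants $c_1,\dots,c_K$. Depending on its state and on the sign of the real $x$ under the reading head, it passes to a new state and either copies, adds or multiplies $x$ to the real $y$ under the writing head, subtracts $x$ from $y$, divides $y$ by $x$ (if $x\neq 0$), copies some $c_j$ to $y$, moves one of the heads by one cell, or halts. On input $\vec x\in\mathbb{R}^n$ it starts with tape contents $(n,x_1,\dots,x_n)$; it outputs $(y_1,\dots,y_m)$ if it halts with tape contents $(m,y_1,\dots,y_m,\dots)$, $m\in\mathbb{N}$, and has no output otherwise. **Programs.** Fix reals $\vec z=(z_1,\dots,z_D)$, $D\ge 0$. The discrete control $\delta$ of a machine is identified with its Gödel number in $\mathbb N$, and $\langle\cdot,\cdot\rangle:\mathbb{N}\times\mathbb{R}\to\mathbb{R}$ is the injective pairing $\langle n,x\rangle=\operatorname{sign}(x)\cdot\big(2^n(2\lfloor|x|\rfloor+1)+|x|-\lfloor|x|\rfloor\big)$ with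 the convention $\operatorname{sign}(0)=1$. The program of a machine with control $\delta$ and constants $c_1,\dots,c_J,z_1,\dots,z_D$ ($J\ge 1$) is the real string $(\langle\delta,c_1\rangle,c_2,\dots,c_J)$ of size $J$. Running a program on an input means running the machine it encodes; in addition, the empty program is defined on the empty input only, where it outputs the empty string. A universal machine $\mathbb{U}_{\vec z}$ is a BSS machine with constants $z_1,\dots,z_D$ which, given a program $\vec p$ and an input $\vec x$ as the string $(\operatorname{size}(\vec p),\vec p,\vec x)$, has the same output (if any) as the program $\vec p$ run on $\vec x$; its behaviour on strings $\vec p$ that are not programs is arbitrary. **Complexity.** $\operatorname{KOL}^{\mathrm o}_{\vec z}(\vec x)\in\mathbb{N}\cup\{\infty\}$ is the minimal size of a string $\vec p$ such that $\mathbb{U}_{\vec z}(\vec p)$, on empty input, outputs $\vec x$ and terminates. Call $\vec x\in\mathbb{R}^*$ *incompressible* (over $\vec z$) if $\operatorname{KOL}^{\mathrm o}_{\vec z}(\vec x)=\operatorname{size}(\vec x)$, both when only programs as above are admitted for $\vec p$ and for every universal machine $\mathbb{U}_{\vec z}$. For a set $X\subseteq\mathbb{R}$ let $\operatorname{trdeg}_{\mathbb{Q}(\vec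 z)}(X)$ be the maximal cardinality of a subset of $X$ that is algebraically independent over $\mathbb{Q}(\vec z)$. **Corollary.** For every $D\ge0$ and $\vec z\in\mathbb{R}^D$: 1. (Existence) For every $n\in\mathbb{N}$ there is an incompressible $\vec x\in[0,1]^n$. 2. (Prevalence) For every $n\in\mathbb{N}$, Lebesgue-almost every $\vec x\in\mathbb{R}^n$ satisfies $\operatorname{trdeg}_{\mathbb{Q}(\vec z)}(\{x_1,\dots,x_n\})=n$ and is incompressible. 3. (Random reals) Let $X_1,\dots,X_n$ be independent real random variables on a probability space, each with an atomless law (for instance, uniformly distributed on $[0,1]$). Then almost surely $\operatorname{trdeg}_{\mathbb{Q}(\vec z)}(\{X_1,\dots,X_n\})=n$ and $(X_1,\dots,X_n)$ is incompressible. -/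

import Mathlib

open MeasureTheory ProbabilityTheory

namespace BSS

/-! ### BSS machines over the reals -/

/-- The elementary actions of a BSS machine with `K` real constants.  Here `x` is the content of the
cell under the reading head and `y` that of the cell under the writing head. -/
inductive Action (K : ℕ) : Type
  | copy                      -- y := x
  | add                       -- y := y + x
  | mul                       -- y := y * x
  | sub                       -- y := y - x
  | div                       -- y := y / x, only for x ≠ 0
  | const (j : Fin K)         -- y := c_j
  | readLeft
  | readRight
  | writeLeft
  | writeRight
  | halt

/-- The (purely discrete) finite control of a BSS machine with `K` constants: `s + 1` states, of
which `0` is the initial one; in a state and depending on the sign of the real under the reading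
head, `δ` gives the action to take and the next state. -/
structure Control (K : ℕ) : Type where
  s : ℕ
  δ : Fin (s + 1) → SignType → Action K × Fin (s + 1)

/-- A BSS machine with `K` constants. -/
structure Machine (K : ℕ) : Type where
  control : Control K
  consts : Fin K → ℝ

/-- A configuration: state, contents of the (two-way unbounded) tape, positions of the heads. -/
structure Cfg (s : ℕ) : Type where
  state : Fin (s + 1)
  tape : ℤ → ℝ
  read : ℤ
  write : ℤ

/-- The initial tape on input `(x₁, …, xₙ)`: cells `0, …, n` hold `n, x₁, …, xₙ`, others `0`. -/
def initTape (x : List ℝ) : ℤ → ℝ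
  | Int.ofNat i => ((x.length : ℝ) :: x).getD i 0
  | Int.negSucc _ => 0

namespace Machine

variable {K : ℕ}

/-- The initial configuration on input `x`. -/
def init (M : Machine K) (x : List ℝ) : Cfg M.control.s := ⟨0, initTape x, 0, 0⟩

/-- The action and next state prescribed in configuration `c`. -/
noncomputable def instr (M : Machine K) (c : Cfg M.control.s) :
    Action K × Fin (M.control.s + 1) :=
  M.control.δ c.state (SignType.sign (c.tape c.read))

/-- One computation step; there is none after `halt`, nor in case of a division by zero. -/
noncomputable def step (M : Machine K) (c : Cfg M.control.s) : Option (Cfg M.control.s) :=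
  let x := c.tape c.read
  let y := c.tape c.write
  let q := (M.instr c).2
  let put : ℝ → Cfg M.control.s := fun v => ⟨q, Function.update c.tape c.write v, c.read, c.write⟩
  match (M.instr c).1 with
  | .copy => some (put x)
  | .add => some (put (y + x))
  | .mul => some (put (y * x))
  | .sub => some (put (y - x))
  | .div => if x = 0 then none else some (put (y / x))
  | .const j => some (put (M.consts j))
  | .readLeft => some ⟨q, c.tape, c.read - 1, c.write⟩
  | .readRight => some ⟨q, c.tape, c.read + 1, c.write⟩
  | .writeLeft => some ⟨q, c.tape, c.read, c.write - 1⟩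
  | .writeRight => some ⟨q, c.tape, c.read, c.write + 1⟩
  | .halt => none

/-- `M.Outputs x y`: on input `x ∈ ℝ*`, the machine `M` reaches a configuration in which it executes
`halt`, and then the tape (from cell `0` on) is of the form `(m, y₁, …, yₘ, …)` with `m ∈ ℕ` and
`y = (y₁, …, yₘ)`.  This is the graph of the partial function `ℝ* ⇀ ℝ*` realized by `M`; in
particular a computation that gets stuck at a division by zero has no output. -/
def Outputs (M : Machine K) (x y : List ℝ) : Prop :=
  ∃ c : Cfg M.control.s,
    Relation.ReflTransGen (fun a b => M.step a = some b) (M.init x) c ∧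
    (M.instr c).1 = Action.halt ∧
    c.tape 0 = (y.length : ℝ) ∧
    ∀ i : Fin y.length, c.tape ((i : ℤ) + 1) = y.get i

end Machine

/-! ### Gödelization -/

/-- Actions as elements of `Fin 10 ⊕ Fin K`. -/
def Action.toSum {K : ℕ} : Action K → Fin 10 ⊕ Fin K
  | .copy => .inl 0
  | .add => .inl 1
  | .mul => .inl 2
  | .sub => .inl 3
  | .div => .inl 4
  | .readLeft => .inl 5
  | .readRight => .inl 6
  | .writeLeft => .inl 7
  | .writeRight => .inl 8
  | .halt => .inl 9
  | .const j => .inr j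

/-- The inverse of `Action.toSum`. -/
def Action.ofSum {K : ℕ} : Fin 10 ⊕ Fin K → Action K
  | .inl 0 => .copy
  | .inl 1 => .add
  | .inl 2 => .mul
  | .inl 3 => .sub
  | .inl 4 => .div
  | .inl 5 => .readLeft
  | .inl 6 => .readRight
  | .inl 7 => .writeLeft
  | .inl 8 => .writeRight
  | .inl 9 => .halt
  | .inr j => .const j

instance {K : ℕ} : Encodable (Action K) :=
  Encodable.ofLeftInverse Action.toSum Action.ofSum (fun a => by cases a <;> rfl)

/-- The control as a finite table, with one row (for negative, zero, positive) per state. -/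
def Control.toTable {K : ℕ} (C : Control K) :
    Σ s : ℕ, Fin (s + 1) →
      (Action K × Fin (s + 1)) × (Action K × Fin (s + 1)) × (Action K × Fin (s + 1)) :=
  ⟨C.s, fun q => (C.δ q .neg, C.δ q .zero, C.δ q .pos)⟩

/-- The inverse of `Control.toTable`. -/
def Control.ofTable {K : ℕ}
    (T : Σ s : ℕ, Fin (s + 1) →
      (Action K × Fin (s + 1)) × (Action K × Fin (s + 1)) × (Action K × Fin (s + 1))) :
    Control K :=
  ⟨T.1, fun q e => match e with
    | .neg => (T.2 q).1
    | .zero => (T.2 q).2.1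
    | .pos => (T.2 q).2.2⟩

/-- The Gödel numbering of controls. -/
instance {K : ℕ} : Encodable (Control K) :=
  Encodable.ofLeftInverse Control.toTable Control.ofTable (fun C => by
    obtain ⟨s, δ⟩ := C
    simp only [Control.toTable, Control.ofTable, Control.mk.injEq, heq_eq_eq, true_and]
    funext q e
    cases e <;> rfl)

/-- The integer/real pairing function
`⟨n, x⟩ = sign(x) · (2ⁿ · (2⌊|x|⌋ + 1) + (|x| - ⌊|x|⌋))`, where `sign(0) = 1`. -/
noncomputable def pair (n : ℕ) (x : ℝ) : ℝ :=
  (if x < 0 then -1 else 1) * (2 ^ n * (2 * (⌊|x|⌋₊ : ℝ) + 1) + (|x| - (⌊|x|⌋₊ : ℝ)))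

/-- The pairing function is injective, so a machine is determined by its code. -/
theorem pair_injective {n m : ℕ} {x y : ℝ} (h : pair n x = pair m y) : n = m ∧ x = y := by
  have key : ∀ (n : ℕ) (x : ℝ), ∃ (k : ℕ) (f : ℝ), |x| = k + f ∧ 0 ≤ f ∧ f < 1 ∧
      pair n x = (if x < 0 then -1 else 1) * (((2 ^ n * (2 * k + 1) : ℕ) : ℝ) + f) := by
    intro n x
    refine ⟨⌊|x|⌋₊, |x| - ⌊|x|⌋₊, by ring, ?_, ?_, by simp [pair]⟩
    · have := Nat.floor_le (abs_nonneg x); linarith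
    · have := Nat.lt_floor_add_one (|x|); linarith
  obtain ⟨k, f, hx, f0, f1, e1⟩ := key n x
  obtain ⟨l, g, hy, g0, g1, e2⟩ := key m y
  have pos : ∀ n k : ℕ, (0 : ℝ) < ((2 ^ n * (2 * k + 1) : ℕ) : ℝ) := fun n k => by positivity
  have p1 := pos n k
  have p2 := pos m l
  rw [e1, e2] at h
  have hs : (x < 0 ↔ y < 0) := by
    by_cases hx0 : x < 0 <;> by_cases hy0 : y < 0 <;> simp only [hx0, hy0, if_true, if_false] at h ⊢
    all_goals exfalso; linarith
  have h' : ((2 ^ n * (2 * k + 1) : ℕ) : ℝ) + f = ((2 ^ m * (2 * l + 1) : ℕ) : ℝ) + g := by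
    by_cases hx0 : x < 0
    · simp only [hx0, hs.1 hx0, if_true] at h; linarith
    · simp only [hx0, mt hs.2 hx0, if_false] at h; linarith
  have hN : 2 ^ n * (2 * k + 1) = 2 ^ m * (2 * l + 1) := by
    have a1 : ((2 ^ n * (2 * k + 1) : ℕ) : ℝ) < ((2 ^ m * (2 * l + 1) + 1: ℕ) : ℝ) := by
      push_cast at *; linarith
    have a2 : ((2 ^ m * (2 * l + 1) : ℕ) : ℝ) < ((2 ^ n * (2 * k + 1) + 1: ℕ) : ℝ) := by
      push_cast at *; linarith
    have := Nat.cast_lt.1 a1; have := Nat.cast_lt.1 a2; omega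
  have hnm : n = m := by
    have v : ∀ n k : ℕ, (2 ^ n * (2 * k + 1)).factorization 2 = n := by
      intro n k
      rw [Nat.factorization_mul (by positivity) (by positivity)]
      simp [Nat.factorization_eq_zero_of_not_dvd (show ¬ 2 ∣ 2 * k + 1 by omega), Nat.prime_two]
    rw [← v n k, hN, v]
  subst hnm
  have hkl : k = l := by
    have := Nat.eq_of_mul_eq_mul_left (by positivity) hN; omega
  subst hkl
  have hab : |x| = |y| := by rw [hx, hy]; linarith
  refine ⟨rfl, ?_⟩
  by_cases hx0 : x < 0
  · rw [abs_of_neg hx0, abs_of_neg (hs.1 hx0)] at hab; linarith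
  · rw [abs_of_nonneg (not_lt.1 hx0), abs_of_nonneg (not_lt.1 (mt hs.2 hx0))] at hab; exact hab

/-- For fixed reals `z₁, …, z_D`: the code `(⟨δ, c₀⟩, c₁, …, c_J)` of the machine with control `δ` and
constants `c₀, …, c_J, z₁, …, z_D`; its size is the number `J + 1` of constants other than the
`z_d`. -/
noncomputable def code {D J : ℕ} (δ : Control (J + 1 + D)) (c : Fin (J + 1) → ℝ) : List ℝ :=
  pair (Encodable.encode δ) (c 0) :: List.ofFn (fun j : Fin J => c j.succ)

/-! ### Universal machines and Kolmogorov complexity -/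

/-- `universal z p x y`: the program `p ∈ ℝ*`, hosted by the universal machine with constants
`z₁, …, z_D`, outputs `y` on input `x`.  That is, `p` is the code of a machine with constants
`c₀, …, c_J, z₁, …, z_D` which outputs `y` on input `x`; or `p` is the empty program, which
terminates only on the empty input and then outputs the empty string. -/
def universal {D : ℕ} (z : Fin D → ℝ) (p x y : List ℝ) : Prop :=
  (p = [] ∧ x = [] ∧ y = []) ∨
  ∃ (J : ℕ) (δ : Control (J + 1 + D)) (c : Fin (J + 1) → ℝ),
    p = code δ c ∧ (Machine.mk δ (Fin.append c z)).Outputs x y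

/-- What a machine `U`, regarded as an interpreter, computes from a program `p` and an input `x`:
the pair is presented to it as the real string `(size p, p, x)`. -/
def Machine.interpret {D : ℕ} (U : Machine D) (p x y : List ℝ) : Prop :=
  U.Outputs ((p.length : ℝ) :: (p ++ x)) y

/-- `U` is a universal machine with constants `z₁, …, z_D`: it simulates the programs above.  Nothing
is required of it on strings `p` which are not programs. -/
def IsUniversal {D : ℕ} (z : Fin D → ℝ) (U : Machine D) : Prop :=
  U.consts = z ∧
  (∀ x y : List ℝ, U.interpret [] x y ↔ universal z [] x y) ∧
  ∀ (J : ℕ) (δ : Control (J + 1 + D)) (c : Fin (J + 1) → ℝ) (x y : List ℝ),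
    U.interpret (code δ c) x y ↔ universal z (code δ c) x y

/-- The real Kolmogorov complexity (output version) of `x ∈ ℝ*` with respect to an interpreter: the
minimal size of a program which, on empty input, outputs `x` (and `⊤` if there is none). -/
noncomputable def kolmogorov (exec : List ℝ → List ℝ → List ℝ → Prop) (x : List ℝ) : ℕ∞ :=
  ⨅ (p : List ℝ) (_ : exec p [] x), (p.length : ℕ∞)

/-- `x` is incompressible over `z`: its Kolmogorov complexity equals its size.  This is asked for
the interpreter `universal z` and also for every universal machine with constants `z`. -/
def Incompressible {D : ℕ} (z : Fin D → ℝ) (x : List ℝ) : Prop :=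
  kolmogorov (universal z) x = x.length ∧
  ∀ U : Machine D, IsUniversal z U → kolmogorov U.interpret x = x.length

/-! ### Transcendence degree -/

/-- The transcendence degree of a set of reals over a subfield `E` of `ℝ`: the maximal cardinality
of a subset that is algebraically independent over `E`. -/
noncomputable def trdeg (E : IntermediateField ℚ ℝ) (X : Set ℝ) : ℕ∞ :=
  ⨆ (Y : Set ℝ) (_ : Y ⊆ X ∧ AlgebraicIndependent E ((↑) : Y → ℝ)), Y.encard

/-- The field `ℚ(z₁, …, z_D)`. -/
noncomputable abbrev ratField {D : ℕ} (z : Fin D → ℝ) : IntermediateField ℚ ℝ :=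
  IntermediateField.adjoin ℚ (Set.range z)

end BSS

namespace BSS

/-! ### The field generated by input and constants -/

/-! Algebraic independence over `ℚ(z)` forces incompressibility, and almost every string is
algebraically independent. Lower bound: a machine only performs field operations, so its output lies
in the field generated by its input and constants (`Machine.Outputs.mem`). A program of size `m`
contributes only `m` reals beyond `ℚ(z)`, and a field generated by `m` elements contains no more
than `m` independent ones (`card_le_of_mem_adjoin`). Upper bound: a straight-line machine with the
entries of the string as its constants prints them (`outputs_printActions`), and its code has the
same size as the string. Measure: a nonzero polynomial vanishes only on a null set of a product of
atomless measures (`ae_eval_ne_zero`), and `ℚ(z)` is countable, so countably many null sets are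
discarded. Existence follows since the unit cube has positive volume. -/

theorem Machine.step_tape_mem {K : ℕ} (M : Machine K) (F : Subfield ℝ) (hc : ∀ j, M.consts j ∈ F)
    {a b : Cfg M.control.s} (h : M.step a = some b) (ha : ∀ i, a.tape i ∈ F) (i : ℤ) :
    b.tape i ∈ F := by
  have put : ∀ v ∈ F, Function.update a.tape a.write v i ∈ F := by
    intro v hv
    by_cases hi : i = a.write
    · subst hi; simpa using hv
    · simpa [Function.update_of_ne hi] using ha i
  unfold Machine.step at h
  cases hact : (M.instr a).1 with
  | div =>
    simp only [hact] at h
    split_ifs at h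
    simp only [Option.some.injEq] at h
    subst h
    exact put _ (F.div_mem (ha _) (ha _))
  | halt => simp [hact] at h
  | _ =>
    simp only [hact, Option.some.injEq] at h
    subst h
    first
      | exact ha i
      | exact put _ (ha _)
      | exact put _ (F.add_mem (ha _) (ha _))
      | exact put _ (F.mul_mem (ha _) (ha _))
      | exact put _ (F.sub_mem (ha _) (ha _))
      | exact put _ (hc _)

theorem initTape_mem (F : Subfield ℝ) {x : List ℝ} (hx : ∀ a ∈ x, a ∈ F) (i : ℤ) :
    initTape x i ∈ F := by
  cases i with
  | negSucc i => exact F.zero_mem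
  | ofNat i =>
    show ((x.length : ℝ) :: x).getD i 0 ∈ F
    rw [List.getD_eq_getElem?_getD]
    cases h : ((x.length : ℝ) :: x)[i]? with
    | none => exact F.zero_mem
    | some a =>
      rcases List.mem_cons.1 (List.mem_of_getElem? h) with rfl | h
      · exact natCast_mem F _
      · exact hx _ h

/-- The entries of the output of a machine lie in the field generated by input and constants. -/
theorem Machine.Outputs.mem {K : ℕ} {M : Machine K} {F : Subfield ℝ} (hc : ∀ j, M.consts j ∈ F)
    {x y : List ℝ} (hx : ∀ a ∈ x, a ∈ F) (h : M.Outputs x y) : ∀ a ∈ y, a ∈ F := by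
  obtain ⟨c, hr, -, -, hy⟩ := h
  have key : ∀ i, c.tape i ∈ F := by
    clear hy
    induction hr with
    | refl => exact initTape_mem F hx
    | tail _ h ih => exact M.step_tape_mem F hc h ih
  intro a ha
  obtain ⟨i, rfl⟩ := List.get_of_mem ha
  rw [← hy i]
  exact key _

/-! ### Straight-line programs -/

/-- The effect of an action on the tape and the positions of the heads. -/
noncomputable def Action.apply {K : ℕ} (c : Fin K → ℝ) (p : (ℤ → ℝ) × ℤ × ℤ) :
    Action K → Option ((ℤ → ℝ) × ℤ × ℤ)
  | .copy => some (Function.update p.1 p.2.2 (p.1 p.2.1), p.2)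
  | .add => some (Function.update p.1 p.2.2 (p.1 p.2.2 + p.1 p.2.1), p.2)
  | .mul => some (Function.update p.1 p.2.2 (p.1 p.2.2 * p.1 p.2.1), p.2)
  | .sub => some (Function.update p.1 p.2.2 (p.1 p.2.2 - p.1 p.2.1), p.2)
  | .div => if p.1 p.2.1 = 0 then none
      else some (Function.update p.1 p.2.2 (p.1 p.2.2 / p.1 p.2.1), p.2)
  | .const j => some (Function.update p.1 p.2.2 (c j), p.2)
  | .readLeft => some (p.1, p.2.1 - 1, p.2.2)
  | .readRight => some (p.1, p.2.1 + 1, p.2.2)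
  | .writeLeft => some (p.1, p.2.1, p.2.2 - 1)
  | .writeRight => some (p.1, p.2.1, p.2.2 + 1)
  | .halt => none

/-- The control which executes a list of actions one after the other and then halts. -/
def Control.ofList {K : ℕ} (l : List (Action K)) : Control K where
  s := l.length
  δ q _ := if h : (q : ℕ) < l.length then (l[(q : ℕ)], ⟨q + 1, by omega⟩) else (.halt, q)

theorem Machine.step_of_apply {K : ℕ} (l : List (Action K)) (c : Fin K → ℝ)
    (p p' : (ℤ → ℝ) × ℤ × ℤ) (q : ℕ) (h : q < l.length) (hp : l[q].apply c p = some p') :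
    (Machine.mk (Control.ofList l) c).step
        ⟨⟨q, Nat.lt_succ_of_lt h⟩, p.1, p.2.1, p.2.2⟩ =
      some ⟨⟨q + 1, Nat.succ_lt_succ h⟩, p'.1, p'.2.1, p'.2.2⟩ := by
  have hi : (Machine.mk (Control.ofList l) c).instr
      ⟨⟨q, Nat.lt_succ_of_lt h⟩, p.1, p.2.1, p.2.2⟩ = (l[q], ⟨q + 1, Nat.succ_lt_succ h⟩) := by
    simp [Machine.instr, Control.ofList, h]
  unfold Machine.step
  simp only [hi]
  cases hact : l[q] with
  | div =>
    rw [hact] at hp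
    simp only [Action.apply] at hp
    split_ifs at hp with h0
    simp only [Option.some.injEq] at hp
    subst hp
    simp [h0]
  | halt => rw [hact] at hp; simp [Action.apply] at hp
  | _ =>
    rw [hact] at hp
    simp only [Action.apply, Option.some.injEq] at hp
    subst hp
    rfl

/-- The state counts the actions already executed. The induction runs over the remaining actions
`l₂` while the machine, built from the whole of `l`, stays fixed. -/
theorem Machine.reach_of_foldlM {K : ℕ} (c : Fin K → ℝ) (l l₁ l₂ : List (Action K))
    (hl : l = l₁ ++ l₂) (p p' : (ℤ → ℝ) × ℤ × ℤ)
    (hp : l₂.foldlM (fun p a => a.apply c p) p = some p') :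
    Relation.ReflTransGen (fun a b => (Machine.mk (Control.ofList l) c).step a = some b)
      ⟨⟨l₁.length, by simp [hl, Control.ofList]⟩, p.1, p.2.1, p.2.2⟩
      ⟨⟨l.length, by simp [Control.ofList]⟩, p'.1, p'.2.1, p'.2.2⟩ := by
  induction l₂ generalizing l₁ p with
  | nil =>
    simp only [List.foldlM_nil, Option.pure_def, Option.some.injEq] at hp
    subst hp
    simp only [List.append_nil] at hl
    subst hl
    exact .refl
  | cons a l₂ ih =>
    rw [List.foldlM_cons] at hp
    obtain ⟨p₁, h₁, h₂⟩ := Option.bind_eq_some_iff.1 hp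
    have hq : l₁.length < l.length := by simp [hl]
    have ha : l[l₁.length] = a := by simp [hl]
    have := ih (l₁ ++ [a]) (by simp [hl]) p₁ h₂
    refine .head (Machine.step_of_apply l c p p₁ l₁.length hq (by rw [ha]; exact h₁)) ?_
    convert this using 3
    simp

theorem Machine.outputs_ofList {K : ℕ} (c : Fin K → ℝ) (l : List (Action K)) (x y : List ℝ)
    (p : (ℤ → ℝ) × ℤ × ℤ)
    (hp : l.foldlM (fun p a => a.apply c p) (initTape x, 0, 0) = some p)
    (h0 : p.1 0 = y.length) (hy : ∀ i : Fin y.length, p.1 ((i : ℤ) + 1) = y.get i) :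
    (Machine.mk (Control.ofList l) c).Outputs x y := by
  refine ⟨_, Machine.reach_of_foldlM c l [] l rfl _ _ hp, ?_, h0, hy⟩
  simp [Machine.instr, Control.ofList]

/-! ### A program printing its constants -/

theorem foldlM_cons_of_apply {K : ℕ} {c : Fin K → ℝ} {a : Action K} {p p' : (ℤ → ℝ) × ℤ × ℤ}
    (h : a.apply c p = some p') (l : List (Action K)) :
    (a :: l).foldlM (fun p a => a.apply c p) p = l.foldlM (fun p a => a.apply c p) p' := by
  rw [List.foldlM_cons, h, Option.bind_eq_bind, Option.bind_some]

theorem foldlM_replicate_add {K : ℕ} (c : Fin K → ℝ) (k : ℕ) (t : ℤ → ℝ) (r w : ℤ) (hrw : r ≠ w) :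
    (List.replicate k (Action.add : Action K)).foldlM (fun p a => a.apply c p) (t, r, w) =
      some (Function.update t w (t w + k * t r), r, w) := by
  induction k generalizing t with
  | zero => simp
  | succ k ih =>
    rw [List.replicate_succ, foldlM_cons_of_apply rfl, ih]
    simp only [Function.update_self, Function.update_of_ne hrw, Function.update_idem]
    push_cast
    ring_nf

/-- That cells up to `w` stay untouched protects the length stored in cell `0`, and in the induction
the constant printed just before. -/
theorem foldlM_print {K : ℕ} (c : Fin K → ℝ) (l : List (Fin K)) (t : ℤ → ℝ) (r w : ℤ) :
    ∃ t' : ℤ → ℝ, (l.flatMap fun j => [Action.writeRight, Action.const j]).foldlM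
        (fun p a => a.apply c p) (t, r, w) = some (t', r, w + l.length) ∧
      (∀ i ≤ w, t' i = t i) ∧ ∀ (i : ℕ) (h : i < l.length), t' (w + 1 + i) = c l[i] := by
  induction l generalizing t w with
  | nil => exact ⟨t, by simp, fun _ _ => rfl, by simp⟩
  | cons j l ih =>
    obtain ⟨t', h, h₁, h₂⟩ := ih (Function.update t (w + 1) (c j)) (w + 1)
    refine ⟨t', ?_, ?_, ?_⟩
    · rw [List.flatMap_cons, List.cons_append, List.cons_append, List.nil_append,
        foldlM_cons_of_apply rfl, foldlM_cons_of_apply rfl, h, List.length_cons]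
      push_cast
      ring_nf
    · intro i hi
      rw [h₁ i (by omega), Function.update_of_ne (by omega)]
    · intro i hi
      cases i with
      | zero => simp [h₁ (w + 1) le_rfl]
      | succ i =>
        have := h₂ i (by simpa using hi)
        rw [List.getElem_cons_succ, ← this]
        push_cast
        ring_nf

/-- The actions that print `n + 1` constants `c₀, …, cₙ`, using that `c₀ ≠ 0`. -/
def printActions {n D : ℕ} : List (Action (n + 1 + D)) :=
  [.const (Fin.castAdd D 0), .div, .writeRight, .copy, .readRight, .writeLeft] ++
    (List.replicate n .add ++
      ((List.finRange (n + 1)).map (Fin.castAdd D)).flatMap fun j => [.writeRight, .const j])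

/-- The length `n + 1` must be produced without spending a constant on it. With both heads on cell
`0`, dividing `x 0` by itself gives `1`; this is copied to cell `1` and added `n` times to cell `0`.
Printing then overwrites the auxiliary `1`. -/
theorem outputs_printActions {n D : ℕ} (x : Fin (n + 1) → ℝ) (z : Fin D → ℝ) (hx : x 0 ≠ 0) :
    (Machine.mk (Control.ofList printActions) (Fin.append x z)).Outputs [] (List.ofFn x) := by
  set c := Fin.append x z with hc
  set t₁ : ℤ → ℝ := Function.update (Function.update (initTape []) 0 1) 1 1 with ht₁
  have h₁ : [Action.const (Fin.castAdd D 0), .div, .writeRight, .copy, .readRight,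
      .writeLeft].foldlM (fun p a => a.apply c p) (initTape [], 0, 0) = some (t₁, 1, 0) := by
    simp [Action.apply, hc, hx, ht₁]
  have h₂ := foldlM_replicate_add c n t₁ 1 0 one_ne_zero
  obtain ⟨t', h₃, h₄, h₅⟩ := foldlM_print c ((List.finRange (n + 1)).map (Fin.castAdd D))
    (Function.update t₁ 0 (t₁ 0 + n * t₁ 1)) 1 0
  refine Machine.outputs_ofList c printActions _ _
    (t', 1, 0 + (((List.finRange (n + 1)).map (Fin.castAdd D)).length : ℤ)) ?_ ?_ ?_
  · rw [printActions, List.foldlM_append, h₁, Option.bind_eq_bind, Option.bind_some,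
      List.foldlM_append, h₂, Option.bind_eq_bind, Option.bind_some, h₃]
  · simp [h₄ 0 le_rfl, ht₁, add_comm]
  · intro i
    have := h₅ i (by simpa using i.2)
    simp only [zero_add, List.getElem_map, List.getElem_finRange, hc, Fin.append_left] at this
    show t' ((i : ℤ) + 1) = _
    rw [add_comm, this, List.get_ofFn]
    rfl

/-! ### Transcendence degree -/

theorem card_le_of_mem_adjoin {E : IntermediateField ℚ ℝ} {n m : ℕ} {x : Fin n → ℝ}
    (hx : AlgebraicIndependent E x) (p : Fin m → ℝ)
    (h : ∀ i, x i ∈ IntermediateField.adjoin E (Set.range p)) : n ≤ m := by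
  let A := IntermediateField.adjoin E (Set.range p)
  let x' : Fin n → A := fun i => ⟨x i, h i⟩
  have hx' : AlgebraicIndependent E x' :=
    (AlgHom.algebraicIndependent_iff A.val A.val.injective).1 hx
  let p' : Fin m → A := fun i => ⟨p i, IntermediateField.subset_adjoin _ _ ⟨i, rfl⟩⟩
  -- The field `A` is generated by `p'`, and being algebraic over the ring `E[p']` is preserved by
  -- all field operations, so `p'` bounds the transcendence degree of `A`.
  have halg : Algebra.IsAlgebraic (Algebra.adjoin E (Set.range p')) A := by
    refine ⟨fun ⟨a, ha⟩ => ?_⟩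
    induction ha using IntermediateField.adjoin_induction with
    | mem a ha =>
      obtain ⟨i, rfl⟩ := ha
      exact isAlgebraic_algebraMap
        (⟨p' i, Algebra.subset_adjoin ⟨i, rfl⟩⟩ : Algebra.adjoin E (Set.range p'))
    | algebraMap a =>
      exact isAlgebraic_algebraMap (algebraMap E (Algebra.adjoin E (Set.range p')) a)
    | add a b _ _ ha hb => exact ha.add hb
    | mul a b _ _ ha hb => exact ha.mul hb
    | inv a _ ha => exact ha.inv
  have h1 := hx'.cardinalMk_le_trdeg
  have h2 := Algebra.IsAlgebraic.trdeg_le_cardinalMk E (Set.range p')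
  have h3 : Cardinal.mk (Set.range p') ≤ Cardinal.mk (Fin m) := Cardinal.mk_range_le
  simpa using (h1.trans h2).trans h3

theorem trdeg_range_eq {E : IntermediateField ℚ ℝ} {n : ℕ} {x : Fin n → ℝ}
    (hx : AlgebraicIndependent E x) : trdeg E (Set.range x) = n := by
  have hn : (Set.range x).encard = n := by
    rw [← Set.image_univ, hx.injective.encard_image]
    simp
  refine le_antisymm (iSup₂_le fun Y hY => hn ▸ Set.encard_le_encard hY.1) ?_
  rw [← hn]
  exact le_iSup₂_of_le (Set.range x) ⟨subset_rfl, hx.coe_range⟩ le_rfl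

/-! ### Almost sure algebraic independence -/

/-- Induction with Fubini: as a polynomial in the variable `0`, `p` has a nonzero coefficient, which
by induction does not vanish at almost every choice `y` of the other variables. For such `y` only
finitely many values of variable `0` are roots, a null set because `ν 0` has no atoms. -/
theorem ae_eval_ne_zero {n : ℕ} (ν : Fin n → Measure ℝ) [∀ i, SigmaFinite (ν i)]
    [∀ i, NullSingletonClass (ν i)] (p : MvPolynomial (Fin n) ℝ) (hp : p ≠ 0) :
    ∀ᵐ x ∂Measure.pi ν, MvPolynomial.eval x p ≠ 0 := by
  induction n with
  | zero =>
    refine .of_forall fun x h => hp ?_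
    rw [MvPolynomial.eq_C_of_isEmpty p] at h ⊢
    simpa using h
  | succ n ih =>
    have hq : MvPolynomial.finSuccEquiv ℝ n p ≠ 0 := by simpa using hp
    obtain ⟨k, hk⟩ := Polynomial.ext_iff.not.trans not_forall |>.1 hq
    have hmeas : MeasurableSet {x : Fin (n + 1) → ℝ | MvPolynomial.eval x p ≠ 0} :=
      (isOpen_ne_fun (MvPolynomial.continuous_eval p) continuous_const).measurableSet
    have hmp := (measurePreserving_piFinSuccAbove ν 0).symm
    rw [← hmp.map_eq, ae_map_iff hmp.measurable.aemeasurable hmeas]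
    have hae := ih (fun j => ν (Fin.succAbove 0 j)) _ hk
    -- The factors are swapped so that Fubini fixes the tail first and lets variable `0` vary.
    have hswap : ∀ᵐ y ∂(Measure.pi fun j => ν (Fin.succAbove 0 j)).prod (ν 0),
        MvPolynomial.eval ((MeasurableEquiv.piFinSuccAbove (fun _ => ℝ) 0).symm y.swap) p ≠ 0 := by
      rw [Measure.ae_prod_iff_ae_ae]
      · filter_upwards [hae] with y hy
        have hpoly : Polynomial.map (MvPolynomial.eval y) (MvPolynomial.finSuccEquiv ℝ n p) ≠ 0 := by
          intro h0
          apply hy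
          have := congrArg (fun f => Polynomial.coeff f k) h0
          simpa using this
        have hfin := (Polynomial.map (MvPolynomial.eval y)
          (MvPolynomial.finSuccEquiv ℝ n p)).roots.toFinset.finite_toSet
        filter_upwards [compl_mem_ae_iff.2 (hfin.measure_zero (ν 0))] with a ha h0
        apply ha
        have : MvPolynomial.eval (Fin.cons a y : Fin (n + 1) → ℝ) p = 0 := by
          rw [← h0, ← Fin.insertNth_zero']; rfl
        rw [MvPolynomial.eval_eq_eval_mv_eval'] at this
        simp only [Finset.mem_coe, Multiset.mem_toFinset]
        exact (Polynomial.mem_roots hpoly).2 this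
      · exact hmeas.preimage ((MeasurableEquiv.measurable _).comp measurable_swap)
    have := Measure.measurePreserving_swap (μ := ν 0)
      (ν := Measure.pi fun j => ν (Fin.succAbove 0 j))
    rw [← this.map_eq] at hswap
    have := ae_of_ae_map this.measurable.aemeasurable hswap
    simpa using this

theorem ae_algebraicIndependent (E : IntermediateField ℚ ℝ) [Countable E] {n : ℕ}
    (ν : Fin n → Measure ℝ) [∀ i, SigmaFinite (ν i)] [∀ i, NullSingletonClass (ν i)] :
    ∀ᵐ x ∂Measure.pi ν, AlgebraicIndependent E x := by
  have : Countable (MvPolynomial (Fin n) E) := by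
    rw [← Cardinal.mk_le_aleph0_iff]
    refine MvPolynomial.cardinalMk_le_max.trans ?_
    simp
  have h : ∀ᵐ x ∂Measure.pi ν, ∀ p : MvPolynomial (Fin n) E, p ≠ 0 →
      MvPolynomial.aeval x p ≠ 0 := by
    rw [ae_all_iff]
    intro p
    by_cases hp : p = 0
    · simp [hp]
    -- Coefficients are moved to `ℝ`, where the induction over the number of variables was carried
    -- out.
    have hp' : MvPolynomial.map (algebraMap E ℝ) p ≠ 0 := by
      rwa [Ne, ← map_zero (MvPolynomial.map (algebraMap E ℝ)),
        (MvPolynomial.map_injective _ (algebraMap E ℝ).injective).eq_iff]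
    filter_upwards [ae_eval_ne_zero ν _ hp'] with x hx _
    rwa [MvPolynomial.eval_map, ← MvPolynomial.aeval_def] at hx
  filter_upwards [h] with x hx
  exact algebraicIndependent_iff.2 fun p hp => by_contra fun h0 => hx p h0 hp

theorem countable_ratField {D : ℕ} (z : Fin D → ℝ) : Countable (ratField z) := by
  rw [← Cardinal.mk_le_aleph0_iff]
  refine (IntermediateField.cardinalMk_adjoin_le ℚ (Set.range z)).trans ?_
  simp

/-! ### Incompressibility -/

/-- A machine whose constants and inputs lie in `ℚ(z, p)` outputs an algebraically independent
string of size at most `size p`. -/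
theorem Machine.Outputs.size_le {D K n : ℕ} {z : Fin D → ℝ} {x : Fin n → ℝ}
    (hx : AlgebraicIndependent (ratField z) x) {M : Machine K} {w : List ℝ} (p : List ℝ)
    (hc : ∀ j, M.consts j ∈ IntermediateField.adjoin (ratField z) (Set.range p.get))
    (hw : ∀ a ∈ w, a ∈ IntermediateField.adjoin (ratField z) (Set.range p.get))
    (h : M.Outputs w (List.ofFn x)) : n ≤ p.length :=
  card_le_of_mem_adjoin hx p.get fun i =>
    h.mem (F := (IntermediateField.adjoin (ratField z) (Set.range p.get)).toSubfield) hc hw _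
      (List.mem_ofFn.2 ⟨i, rfl⟩)

theorem mem_adjoin_ratField {D : ℕ} (z : Fin D → ℝ) (S : Set ℝ) (j : Fin D) :
    z j ∈ IntermediateField.adjoin (ratField z) S :=
  (IntermediateField.adjoin (ratField z) S).algebraMap_mem
    ⟨z j, IntermediateField.subset_adjoin ℚ _ ⟨j, rfl⟩⟩

theorem length_code {D J : ℕ} (δ : Control (J + 1 + D)) (c : Fin (J + 1) → ℝ) :
    (code δ c).length = J + 1 := by
  simp [code]

theorem size_le_of_universal {D n : ℕ} {z : Fin D → ℝ} {x : Fin n → ℝ}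
    (hx : AlgebraicIndependent (ratField z) x) {p : List ℝ}
    (h : universal z p [] (List.ofFn x)) : n ≤ p.length := by
  rcases h with ⟨-, -, h⟩ | ⟨J, δ, c, rfl, h⟩
  · have := congrArg List.length h
    simp only [List.length_ofFn, List.length_nil] at this
    omega
  -- The generators are the constants `c`, not the entries of the code; only their common number `J
  -- + 1` matters.
  · have := h.size_le hx (List.ofFn c) (fun j => ?_) (by simp)
    · simpa [length_code] using this
    · induction j using Fin.addCases with
      | left j =>
        simp only [Fin.append_left]
        refine IntermediateField.subset_adjoin _ _ ?_
        rw [Set.range_list_get]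
        exact List.mem_ofFn.2 ⟨j, rfl⟩
      | right j =>
        simp only [Fin.append_right]
        exact mem_adjoin_ratField z _ j

/-- Here `p` is part of the input and its entries are the generators, so the bound covers strings
that are not programs; the leading entry `size p` is an integer and costs nothing. -/
theorem size_le_of_interpret {D n : ℕ} {z : Fin D → ℝ} {x : Fin n → ℝ}
    (hx : AlgebraicIndependent (ratField z) x) {U : Machine D} (hU : U.consts = z) {p : List ℝ}
    (h : U.interpret p [] (List.ofFn x)) : n ≤ p.length := by
  refine Machine.Outputs.size_le hx p (fun j => hU ▸ mem_adjoin_ratField U.consts _ j) ?_ h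
  intro a ha
  rw [List.append_nil] at ha
  rcases List.mem_cons.1 ha with rfl | ha
  · exact natCast_mem _ _
  · refine IntermediateField.subset_adjoin _ _ ?_
    rw [Set.range_list_get]
    exact ha

/-- A string over `z` which is algebraically independent is printed by a program of the same size,
which is empty or the code of a machine. -/
theorem exists_program {D n : ℕ} {z : Fin D → ℝ} {x : Fin n → ℝ}
    (hx : AlgebraicIndependent (ratField z) x) :
    ∃ p : List ℝ, p.length = n ∧ universal z p [] (List.ofFn x) ∧
      (p = [] ∨ ∃ (J : ℕ) (δ : Control (J + 1 + D)) (c : Fin (J + 1) → ℝ), p = code δ c) := by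
  cases n with
  | zero => exact ⟨[], rfl, .inl ⟨rfl, rfl, by simp⟩, .inl rfl⟩
  | succ n =>
    exact ⟨_, length_code _ x, .inr ⟨n, _, x, rfl, outputs_printActions x z (hx.ne_zero 0)⟩,
      .inr ⟨n, _, x, rfl⟩⟩

theorem kolmogorov_eq {exec : List ℝ → List ℝ → List ℝ → Prop} {x p : List ℝ}
    (hp : exec p [] x) (hlen : p.length = x.length)
    (h : ∀ q, exec q [] x → x.length ≤ q.length) : kolmogorov exec x = x.length :=
  le_antisymm (hlen ▸ iInf₂_le p hp) (le_iInf₂ fun q hq => Nat.cast_le.2 (h q hq))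

theorem incompressible_of_algebraicIndependent {D n : ℕ} {z : Fin D → ℝ} {x : Fin n → ℝ}
    (hx : AlgebraicIndependent (ratField z) x) : Incompressible z (List.ofFn x) := by
  obtain ⟨p, hlen, hp, hcode⟩ := exists_program hx
  refine ⟨kolmogorov_eq hp (by simpa using hlen) fun q hq => ?_, fun U hU =>
    kolmogorov_eq (p := p) ?_ (by simpa using hlen) fun q hq => ?_⟩
  · simpa using size_le_of_universal hx hq
  -- A universal machine is constrained only on genuine programs, so the shape of `p` is needed.
  · rcases hcode with rfl | ⟨J, δ, c, rfl⟩
    · exact (hU.2.1 _ _).2 hp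
    · exact (hU.2.2 J δ c _ _).2 hp
  · simpa using size_le_of_interpret hx hU.1 hq

theorem ae_trdeg_eq_and_incompressible {D n : ℕ} (z : Fin D → ℝ) (ν : Fin n → Measure ℝ)
    [∀ i, SigmaFinite (ν i)] [∀ i, NullSingletonClass (ν i)] :
    ∀ᵐ x ∂Measure.pi ν,
      trdeg (ratField z) (Set.range x) = n ∧ Incompressible z (List.ofFn x) := by
  have := countable_ratField z
  filter_upwards [ae_algebraicIndependent (ratField z) ν] with x hx
  exact ⟨trdeg_range_eq hx, incompressible_of_algebraicIndependent hx⟩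

end BSS

theorem mainTheorem8 {D : ℕ} (z : Fin D → ℝ) :
    -- incompressible strings of every size exist, even with entries in `[0, 1]`
    (∀ n : ℕ, ∃ x : Fin n → ℝ, (∀ i, x i ∈ Set.Icc (0 : ℝ) 1) ∧
      BSS.Incompressible z (List.ofFn x)) ∧
    -- Lebesgue-almost every string of size `n` is incompressible, of full transcendence degree
    (∀ n : ℕ, ∀ᵐ x : Fin n → ℝ ∂volume,
      BSS.trdeg (BSS.ratField z) (Set.range x) = n ∧ BSS.Incompressible z (List.ofFn x)) ∧
    -- independent random reals with atomless laws, e.g. uniform on `[0, 1]`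
    (∀ (Ω : Type*) (_ : MeasurableSpace Ω) (μ : Measure Ω) (_ : IsProbabilityMeasure μ)
      (n : ℕ) (X : Fin n → Ω → ℝ), (∀ i, Measurable (X i)) →
      (∀ i, ∀ a : ℝ, μ {ω | X i ω = a} = 0) → iIndepFun X μ →
      ∀ᵐ ω ∂μ,
        BSS.trdeg (BSS.ratField z) (Set.range (fun i => X i ω)) = n ∧
        BSS.Incompressible z (List.ofFn (fun i => X i ω))) := by
  have hvol : ∀ n : ℕ, ∀ᵐ x : Fin n → ℝ ∂volume,
      BSS.trdeg (BSS.ratField z) (Set.range x) = n ∧ BSS.Incompressible z (List.ofFn x) :=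
    fun n => BSS.ae_trdeg_eq_and_incompressible z fun _ => volume
  refine ⟨fun n => ?_, hvol, ?_⟩
  · have hpos : volume (Set.Icc (0 : Fin n → ℝ) 1) ≠ 0 := by simp [Real.volume_Icc_pi]
    obtain ⟨x, hx, -, hinc⟩ :=
      nonempty_of_measure_ne_zero ((measure_inter_conull (hvol n)).trans_ne hpos)
    exact ⟨x, fun i => ⟨hx.1 i, hx.2 i⟩, hinc⟩
  · intro Ω _ μ _ n X hX hatom hind
    -- By independence the joint law is the product of the marginals, which reduces the claim to
    -- product measures.
    have hmap := (iIndepFun_iff_map_fun_eq_pi_map fun i => (hX i).aemeasurable).1 hind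
    have : ∀ i, IsProbabilityMeasure (μ.map (X i)) := fun i =>
      Measure.isProbabilityMeasure_map (hX i).aemeasurable
    have : ∀ i, NullSingletonClass (μ.map (X i)) := fun i =>
      ⟨fun a => by rw [Measure.map_apply (hX i) (measurableSet_singleton a)]; exact hatom i a⟩
    have h := BSS.ae_trdeg_eq_and_incompressible z fun i => μ.map (X i)
    rw [← hmap] at h
    exact ae_of_ae_map (measurable_pi_lambda _ hX).aemeasurable h
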